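/- Let $n\ge 1$ and let $A\in\operatorname{M}_n(\mathbb Z)$ be a non-singular matrix whose characteristic polynomial $h_A\in\mathbb Z[x]$ is irreducible. For a prime $p$ let $t_p$ denote the multiplicity of $0$ as a root of the reduction of $h_A$ modulo $p$. Assume that there is a prime $p$ dividing $\det A$ with $h_A\not\equiv x^n \pmod p$, and that there is a prime $p$ such that $n$ and $t_p$ are coprime. Let $\mathbb T^n=\mathbb R^n/\mathbb Z^n$, let $$\mathbb S_A=\Big\{(z_j)_{j\ge 1}\in\prod_{j=1}^{\infty}\mathbb T^n \;\Big|\; A z_{j+1}=z_j \text{ for all } j\Big\}$$ be the toroidal solenoid defined by $A$, a topological group with the topology induced from the product topology, and let $\sigma:\mathbb S_A\to\mathbb S_A$, $\sigma((z_j))=(Az_j)$, be the automorphism induced by $A$. Let $\operatorname{End}(\mathbb S_A)$ be the ring of continuous group endomorphisms of $\mathbb S_A$ (pointwise addition, composition as multiplication), and $\operatorname{End}(\mathbb S_A,\sigma)$ its subring of endomorphisms commuting with $\sigma$. Then $\operatorname{End}(\mathbb S_A)$ is a commutative ring and, in particular, $\operatorname{End}(\mathbb S_A,\sigma)=\operatorname{End}(\mathbb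 S_A)$. -/

import Mathlib

namespace ToroidalSolenoid

/-- `t_p`: the multiplicity of zero as a root of the reduction modulo `p` of the characteristic
polynomial of `A`. -/
noncomputable def zeroMult {n : ℕ} (A : Matrix (Fin n) (Fin n) ℤ) (p : ℕ) : ℕ :=
  (A.charpoly.map (Int.castRingHom (ZMod p))).rootMultiplicity 0

/-- `𝒫'`: the primes `p` dividing `det A` with `h_A ≢ x ^ n (mod p)`. -/
def primesPrime {n : ℕ} (A : Matrix (Fin n) (Fin n) ℤ) : Set ℕ :=
  {p | p.Prime ∧ (p : ℤ) ∣ A.det ∧ A.charpoly.map (Int.castRingHom (ZMod p)) ≠ Polynomial.X ^ n}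

/-- The map of the torus `𝕋ⁿ = ℝⁿ / ℤⁿ = (ℝ / ℤ)ⁿ` induced by the integer matrix `A`. -/
noncomputable def torusMap {n : ℕ} (A : Matrix (Fin n) (Fin n) ℤ) :
    UnitAddTorus (Fin n) →+ UnitAddTorus (Fin n) where
  toFun z := fun i => ∑ j, A i j • z j
  map_zero' := by
    funext i
    simp
  map_add' z w := by
    funext i
    simp [smul_add, Finset.sum_add_distrib]

/-- `A [x] = [A x]` for `x ∈ ℝⁿ`. -/
theorem torusMap_coe {n : ℕ} (A : Matrix (Fin n) (Fin n) ℤ) (x : Fin n → ℝ) :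
    torusMap A (fun i => ((x i : ℝ) : UnitAddCircle)) =
      fun i => (((A.map (Int.cast : ℤ → ℝ)).mulVec x i : ℝ) : UnitAddCircle) := by
  funext i
  simp [torusMap, Matrix.mulVec, dotProduct]

theorem continuous_torusMap {n : ℕ} (A : Matrix (Fin n) (Fin n) ℤ) :
    Continuous (torusMap A) := by
  refine continuous_pi fun i => ?_
  change Continuous fun z : UnitAddTorus (Fin n) => ∑ j, A i j • z j
  fun_prop

/-- The toroidal solenoid `𝕊_A`: the inverse limit of `𝕋ⁿ ← 𝕋ⁿ ← 𝕋ⁿ ← ⋯` along `A`, as a subgroup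
of the countable power of `𝕋ⁿ`; it carries the subspace topology of the product topology. -/
noncomputable def solenoid {n : ℕ} (A : Matrix (Fin n) (Fin n) ℤ) :
    AddSubgroup (ℕ → UnitAddTorus (Fin n)) where
  carrier := {z | ∀ j, torusMap A (z (j + 1)) = z j}
  zero_mem' j := map_zero (torusMap A)
  add_mem' {z w} hz hw j := by
    rw [Pi.add_apply, map_add, hz j, hw j, Pi.add_apply]
  neg_mem' {z} hz j := by
    rw [Pi.neg_apply, map_neg, hz j, Pi.neg_apply]

/-- The automorphism `σ : (z_j) ↦ (A z_j)` of the topological group `𝕊_A`. -/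
noncomputable def shift {n : ℕ} (A : Matrix (Fin n) (Fin n) ℤ) :
    solenoid A ≃ₜ+ solenoid A where
  toFun z := ⟨fun j => torusMap A (z.1 j), fun j => congrArg (torusMap A) (z.2 j)⟩
  invFun z := ⟨fun j => z.1 (j + 1), fun j => z.2 (j + 1)⟩
  left_inv z := Subtype.ext (funext fun j => z.2 j)
  right_inv z := Subtype.ext (funext fun j => z.2 j)
  map_add' z w := Subtype.ext (funext fun j => map_add (torusMap A) (z.1 j) (w.1 j))
  continuous_toFun := by
    refine Continuous.subtype_mk (continuous_pi fun j => ?_) _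
    exact (continuous_torusMap A).comp ((continuous_apply j).comp continuous_subtype_val)
  continuous_invFun := by
    refine Continuous.subtype_mk (continuous_pi fun j => ?_) _
    exact (continuous_apply (j + 1)).comp continuous_subtype_val

/-- The ring of continuous endomorphisms of a topological abelian group, with pointwise addition
and composition as multiplication. -/
def contEnd (G : Type*) [AddCommGroup G] [TopologicalSpace G] [IsTopologicalAddGroup G] :
    Subring (AddMonoid.End G) where
  carrier := {f | Continuous f}
  mul_mem' {f g} (hf : Continuous f) (hg : Continuous g) :=
    show Continuous (f ∘ g) from hf.comp hg
  one_mem' := continuous_id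
  add_mem' {_ _} hf hg := Continuous.add hf hg
  zero_mem' := continuous_const
  neg_mem' {_} hf := Continuous.neg hf

/-- The endomorphism ring of the dynamical system `(G, s)`: the continuous endomorphisms of the
topological abelian group `G` that commute with the automorphism `s`. -/
def dynEnd (G : Type*) [AddCommGroup G] [TopologicalSpace G] [IsTopologicalAddGroup G]
    (s : G ≃ₜ+ G) : Subring (AddMonoid.End G) where
  carrier := {f | Continuous f ∧ ∀ z, f (s z) = s (f z)}
  mul_mem' {f g} hf hg := ⟨show Continuous (f ∘ g) from hf.1.comp hg.1, fun z =>
    (congrArg f (hg.2 z)).trans (hf.2 (g z))⟩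
  one_mem' := ⟨continuous_id, fun _ => rfl⟩
  add_mem' {f g} hf hg := ⟨Continuous.add hf.1 hg.1, fun z => by
    change f (s z) + g (s z) = s (f z + g z)
    rw [hf.2, hg.2, map_add]⟩
  zero_mem' := ⟨continuous_const, fun _ => (map_zero s).symm⟩
  neg_mem' {f} hf := ⟨Continuous.neg hf.1, fun z => by
    change -f (s z) = s (-f z)
    rw [hf.2, map_neg]⟩

end ToroidalSolenoid

/-! A continuous endomorphism is determined on the dense one-parameter subgroups `flow`. Lifting
characters to `ℝ`, together with the absence of small subgroups in the circle, shows that it acts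
there by a rational matrix `T` such that for every `j` some `T A ^ k` lies in `A ^ j M_n(ℤ)`
(`exists_ratMatrix_of_continuous`).

The crux is that such a `T` commutes with `A` (`commute_of_forall_exists_mul_pow`). In a Galois
number field containing the eigenvalues, fix a prime `P` above `p`. Comparing `T A ^ k = A ^ j B` at
`P` kills the block of `T` from the `i`-eigenspace to the `l`-eigenspace when `l ∈ P` and `i ∉ P`.
As `T` is rational, a nonzero block at `(l, i)` forces `σ l ∈ P → σ i ∈ P` for every Galois `σ`.
Exactly `t_p` of the `n` eigenvalues lie in `P`; coprimality makes the Galois translates of this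
subset separate eigenvalues (`eq_of_forall_smul_mem`), so `l = i` and `T` is block diagonal.

Irreducibility makes the centralizer of `A` commutative, so any two endomorphisms commute, and `σ`
is one of them. -/

namespace ToroidalSolenoid
open Polynomial Matrix

/-! ### Separation by translates; centralizers of cyclic matrices -/

/-- If a finite group permutes a finite set `R` transitively, and `S ⊆ R` has cardinality coprime to
that of `R`, then the translates of `S` separate the points of `R`. -/
theorem eq_of_forall_smul_mem {G α : Type*} [Group G] [Finite G] [MulAction G α] [DecidableEq α]
    {R S : Finset α} (hR : ∀ (g : G), ∀ x ∈ R, g • x ∈ R)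
    (htrans : ∀ x ∈ R, ∀ y ∈ R, ∃ g : G, g • x = y) (hS : S ⊆ R)
    (hco : Nat.Coprime R.card S.card) {l i : α} (hl : l ∈ R) (hi : i ∈ R)
    (h : ∀ g : G, g • l ∈ S → g • i ∈ S) : l = i := by
  classical
  let q : α → Set G := fun x => {g | g • x ∈ S}
  have hqsmul : ∀ (k : G) (x : α), q (k • x) = (Equiv.mulRight k) ⁻¹' q x := fun k x => by
    ext g
    simp [q, mul_smul]
  have hcard : ∀ x ∈ R, ∀ y ∈ R, (q x).ncard = (q y).ncard := fun x hx y hy => by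
    obtain ⟨k, rfl⟩ := htrans x hx y hy
    rw [hqsmul, Set.ncard_preimage_of_injective_subset_range (Equiv.injective _)]
    exact fun g _ => ⟨g * k⁻¹, by simp⟩
  have hli : q l = q i :=
    Set.eq_of_subset_of_ncard_le (fun g hg => h g hg) (hcard i hi l hl).le (Set.toFinite _)
  -- The fibres of `q` on `R` are permuted transitively, so all have size `m`. `S` is a union of
  -- fibres, since `y ∈ S` means `1 ∈ q y`. Hence `m` divides both cardinalities.
  set m := (R.filter fun y => q y = q i).card with hm
  have hfib : ∀ x ∈ R, (R.filter fun y => q y = q x).card = m := fun x hx => by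
    obtain ⟨k, rfl⟩ := htrans i hi x hx
    symm
    refine Finset.card_bij (fun y _ => k • y) (fun y hy => ?_) (fun y _ z _ hyz => ?_)
      (fun y hy => ⟨k⁻¹ • y, ?_, ?_⟩)
    · simp only [Finset.mem_filter] at hy ⊢
      exact ⟨hR k y hy.1, by rw [hqsmul, hqsmul, hy.2]⟩
    · exact MulAction.injective k hyz
    · simp only [Finset.mem_filter] at hy ⊢
      refine ⟨hR _ y hy.1, ?_⟩
      rw [hqsmul, hy.2, ← hqsmul, inv_smul_smul]
    · simp
  have h1 : m ∣ R.card := by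
    rw [Finset.card_eq_sum_card_image q R]
    refine Finset.dvd_sum fun b hb => ?_
    obtain ⟨x, hx, rfl⟩ := Finset.mem_image.1 hb
    rw [hfib x hx]
  have h2 : m ∣ S.card := by
    rw [Finset.card_eq_sum_card_image q S]
    refine Finset.dvd_sum fun b hb => ?_
    obtain ⟨x, hx, rfl⟩ := Finset.mem_image.1 hb
    have : (S.filter fun y => q y = q x) = R.filter fun y => q y = q x := by
      ext y
      simp only [Finset.mem_filter]
      refine ⟨fun hy => ⟨hS hy.1, hy.2⟩, fun hy => ⟨?_, hy.2⟩⟩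
      have : (1 : G) ∈ q y := by rw [hy.2]; simpa [q] using hx
      simpa [q] using this
    rw [this, hfib x (hS hx)]
  have hm1 : m = 1 := Nat.dvd_one.1 (hco ▸ Nat.dvd_gcd h1 h2)
  exact Finset.card_le_one.1 hm1.le l (by simp [hl, hli]) i (by simp [hi])

/-- A nonzero vector is cyclic for a matrix with irreducible characteristic polynomial. -/
theorem exists_aeval_mulVec_eq {K : Type*} [Field K] {n : ℕ} {A : Matrix (Fin n) (Fin n) K}
    (hirr : Irreducible A.charpoly) {v : Fin n → K} (hv : v ≠ 0) (w : Fin n → K) :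
    ∃ q : K[X], (aeval A q) *ᵥ v = w := by
  let φ : K[X] →ₗ[K] (Fin n → K) :=
    (Matrix.mulVecBilin K K).flip v ∘ₗ (aeval A).toLinearMap
  have hφ : ∀ q, φ q = (aeval A q) *ᵥ v := fun q => rfl
  let ψ : degreeLT K n →ₗ[K] (Fin n → K) := φ.domRestrict _
  have hinj : Function.Injective ψ := by
    rw [injective_iff_map_eq_zero]
    rintro ⟨q, hq⟩ hq0
    have hq0 : (aeval A q) *ᵥ v = 0 := hq0
    by_contra hne
    have hne : q ≠ 0 := fun h => hne (Subtype.ext h)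
    have hnd : ¬ A.charpoly ∣ q := fun hd => by
      have := degree_le_of_dvd hd hne
      rw [Matrix.charpoly_degree_eq_dim, Fintype.card_fin] at this
      exact absurd (mem_degreeLT.1 hq) (not_lt.2 this)
    -- By Bézout and Cayley–Hamilton, `b(A) q(A) v = v`, whereas `q(A) v = 0`.
    obtain ⟨a, b, hab⟩ := (hirr.coprime_iff_not_dvd.2 hnd)
    have := congrArg (fun r => (aeval A r) *ᵥ v) hab
    simp only [map_add, map_mul, Matrix.aeval_self_charpoly, mul_zero, zero_add, map_one,
      Matrix.one_mulVec, ← Matrix.mulVec_mulVec, hq0, Matrix.mulVec_zero] at this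
    exact hv this.symm
  have hsurj : Function.Surjective ψ := by
    have e := degreeLTEquiv K n
    have : FiniteDimensional K (degreeLT K n) := e.symm.finiteDimensional
    exact (LinearMap.injective_iff_surjective_of_finrank_eq_finrank e.finrank_eq).1 hinj
  obtain ⟨q, hq⟩ := hsurj w
  exact ⟨q, hq⟩

/-- The centralizer of a matrix with irreducible characteristic polynomial is commutative. -/
theorem commute_of_commute_of_irreducible_charpoly {K : Type*} [Field K] {n : ℕ}
    {A S T : Matrix (Fin n) (Fin n) K} (hirr : Irreducible A.charpoly)
    (hS : Commute S A) (hT : Commute T A) : Commute S T := by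
  have hpoly : ∀ {X : Matrix (Fin n) (Fin n) K}, Commute X A → ∀ q : K[X],
      Commute X (aeval A q) := fun {X} hX q => by
    induction q using Polynomial.induction_on' with
    | add p q hp hq => rw [map_add]; exact hp.add_right hq
    | monomial k a =>
      rw [aeval_monomial]
      exact (Algebra.commute_algebraMap_right a X).mul_right (hX.pow_right k)
  rcases Nat.eq_zero_or_pos n with rfl | hn
  · exact Subsingleton.elim _ _
  have hv : (Pi.single ⟨0, hn⟩ 1 : Fin n → K) ≠ 0 := by simp
  set v : Fin n → K := Pi.single ⟨0, hn⟩ 1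
  -- On the cyclic vector, `S` and `T` act as polynomials `s(A)` and `t(A)`; both commute with every
  -- `q(A)`, so agreement of `S T` and `T S` at `v` propagates to all vectors.
  obtain ⟨s, hs⟩ := exists_aeval_mulVec_eq hirr hv (S *ᵥ v)
  obtain ⟨t, ht⟩ := exists_aeval_mulVec_eq hirr hv (T *ᵥ v)
  refine Matrix.ext_of_mulVec_single fun i => ?_
  obtain ⟨q, hq⟩ := exists_aeval_mulVec_eq hirr hv (Pi.single i 1)
  rw [← hq, Matrix.mulVec_mulVec, Matrix.mulVec_mulVec,
    ((hpoly hS q).mul_left (hpoly hT q)).eq, ((hpoly hT q).mul_left (hpoly hS q)).eq]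
  simp only [← Matrix.mulVec_mulVec]
  congr 1
  rw [← ht, Matrix.mulVec_mulVec, (hpoly hS t).eq, ← Matrix.mulVec_mulVec, ← hs,
    Matrix.mulVec_mulVec v T, (hpoly hT s).eq, ← Matrix.mulVec_mulVec, ← ht,
    Matrix.mulVec_mulVec, Matrix.mulVec_mulVec, ← map_mul, ← map_mul, mul_comm]

end ToroidalSolenoid

namespace ToroidalSolenoid
open Polynomial Matrix
open scoped WithZero NumberField

/-! ### Spectral projectors and valuations -/

section SpectralProjector

variable {L : Type*} [Field L] {n : ℕ}

/-- Integers have valuation at most one, so the ultrametric inequality gives a bound uniform in `B`.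
-/
theorem exists_valuation_mul_mul_le (v : Valuation L ℤᵐ⁰) (hv : ∀ m : ℤ, v m ≤ 1)
    (P Q : Matrix (Fin n) (Fin n) L) (a b : Fin n) :
    ∃ c, ∀ B : Matrix (Fin n) (Fin n) ℤ, v ((P * B.map (Int.cast : ℤ → L) * Q) a b) ≤ c := by
  refine ⟨Finset.univ.sup fun x : Fin n × Fin n => v (P a x.1 * Q x.2 b), fun B => ?_⟩
  rw [Matrix.mul_apply]
  refine v.map_sum_le fun d _ => ?_
  rw [Matrix.mul_apply, Finset.sum_mul]
  refine v.map_sum_le fun c _ => ?_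
  refine le_trans ?_ (Finset.le_sup (Finset.mem_univ (c, d)))
  rw [mul_right_comm, map_mul]
  exact mul_le_of_le_one_right' (hv _)

/-- The Lagrange basis polynomial at `x` of a set `R` of nodes, evaluated at the matrix `A`. If `R`
is the set of eigenvalues of `A` and they are all simple, this is the projector onto the eigenspace
of `x` along the other eigenspaces. -/
noncomputable def spectralProj [DecidableEq L] (A : Matrix (Fin n) (Fin n) L) (R : Finset L)
    (x : L) : Matrix (Fin n) (Fin n) L :=
  aeval A (Lagrange.basis R id x)

variable [DecidableEq L] {A : Matrix (Fin n) (Fin n) L} {R : Finset L}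

theorem sum_spectralProj (hR : R.Nonempty) : ∑ x ∈ R, spectralProj A R x = 1 := by
  have := Lagrange.sum_basis (Set.injOn_id (R : Set L)) hR
  simpa [spectralProj] using congrArg (aeval A) this

/-- Multiplying the Lagrange basis polynomial by its missing factor `X - x` gives a multiple of the
characteristic polynomial, so Cayley–Hamilton applies. -/
theorem mul_spectralProj (hA : A.charpoly = ∏ x ∈ R, (X - C x)) {x : L} (hx : x ∈ R) :
    A * spectralProj A R x = x • spectralProj A R x := by
  have h : (X - C x) * Lagrange.basis R id x =
      C (∏ y ∈ R.erase x, (x - y)⁻¹) * A.charpoly := by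
    rw [hA, ← Finset.mul_prod_erase R _ hx, Lagrange.basis, map_prod]
    simp only [Lagrange.basisDivisor, id, Finset.prod_mul_distrib]
    ring
  have := congrArg (aeval A) h
  rw [map_mul, map_mul, Matrix.aeval_self_charpoly, mul_zero, map_sub, aeval_X, aeval_C, sub_mul,
    sub_eq_zero] at this
  rw [spectralProj, this, Algebra.smul_def]

theorem commute_spectralProj (x : L) : Commute A (spectralProj A R x) := by
  have : Commute (aeval A (X : L[X])) (spectralProj A R x) := by
    rw [spectralProj, Commute, SemiconjBy, ← map_mul, ← map_mul, mul_comm]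
  rwa [aeval_X] at this

theorem pow_mul_spectralProj (hA : A.charpoly = ∏ x ∈ R, (X - C x)) {x : L} (hx : x ∈ R) (k : ℕ) :
    A ^ k * spectralProj A R x = x ^ k • spectralProj A R x := by
  induction k with
  | zero => simp
  | succ k ih =>
    rw [pow_succ', mul_assoc, ih, mul_smul_comm, mul_spectralProj hA hx, smul_smul, pow_succ]

theorem spectralProj_mul_pow (hA : A.charpoly = ∏ x ∈ R, (X - C x)) {x : L} (hx : x ∈ R) (k : ℕ) :
    spectralProj A R x * A ^ k = x ^ k • spectralProj A R x := by
  rw [← pow_mul_spectralProj hA hx, ((commute_spectralProj x).pow_left k).eq]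

/-- A matrix which is block diagonal for the eigenspace decomposition of `A` commutes with `A`. -/
theorem commute_of_spectralProj_mul_mul (hA : A.charpoly = ∏ x ∈ R, (X - C x)) (hR : R.Nonempty)
    {T : Matrix (Fin n) (Fin n) L}
    (h : ∀ l ∈ R, ∀ i ∈ R, spectralProj A R l * T * spectralProj A R i ≠ 0 → l = i) :
    Commute A T := by
  have key : ∀ M : Matrix (Fin n) (Fin n) L,
      M = ∑ l ∈ R, ∑ i ∈ R, spectralProj A R l * M * spectralProj A R i := fun M => by
    simp_rw [← Finset.mul_sum, ← Finset.sum_mul]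
    simp [sum_spectralProj hR]
  rw [Commute, SemiconjBy, key (A * T), key (T * A)]
  refine Finset.sum_congr rfl fun l hl => Finset.sum_congr rfl fun i hi => ?_
  have h1 := spectralProj_mul_pow hA hl 1
  have h2 := pow_mul_spectralProj hA hi 1
  rw [pow_one, pow_one] at h1 h2
  rw [← mul_assoc, h1, ← mul_assoc, mul_assoc _ A, h2, smul_mul_assoc, smul_mul_assoc,
    mul_smul_comm]
  by_cases h0 : spectralProj A R l * T * spectralProj A R i = 0
  · simp [h0]
  · rw [h l hl i hi h0]

/-- Galois equivariance: `σ` permutes the nodes, hence the Lagrange basis polynomials, and fixes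
`A`. -/
theorem map_spectralProj (σ : L →+* L) (hσA : A.map σ = A) (hσR : R.image σ = R)
    (x : L) : (spectralProj A R x).map σ = spectralProj A R (σ x) := by
  have h : (Lagrange.basis R id x).map σ = Lagrange.basis R id (σ x) := by
    rw [Lagrange.basis, Lagrange.basis, Polynomial.map_prod]
    conv_rhs => rw [← hσR, ← Finset.image_erase σ.injective, Finset.prod_image σ.injective.injOn]
    simp [Lagrange.basisDivisor]
  rw [spectralProj, spectralProj, ← h]
  change σ.mapMatrix _ = _
  rw [aeval_def, hom_eval₂, aeval_def, eval₂_map]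
  congr 1
  ext a i j
  by_cases hij : i = j <;> simp [hij, Matrix.algebraMap_matrix_apply]
  
/-- If `T` maps `A ^ k ℤⁿ` into `A ^ j ℤⁿ` for every `j` and suitable `k`, then it maps eigenvectors
with unit eigenvalue to sums of eigenvectors with unit eigenvalue. -/
theorem spectralProj_mul_mul_eq_zero (v : Valuation L ℤᵐ⁰) (hv : ∀ m : ℤ, v m ≤ 1)
    (hA : A.charpoly = ∏ x ∈ R, (X - C x)) {T : Matrix (Fin n) (Fin n) L}
    (hT : ∀ j : ℕ, ∃ (k : ℕ) (B : Matrix (Fin n) (Fin n) ℤ), T * A ^ k = A ^ j * B.map Int.cast)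
    {l i : L} (hl : l ∈ R) (hi : i ∈ R) (hvl : v l < 1) (hvi : v i = 1) :
    spectralProj A R l * T * spectralProj A R i = 0 := by
  ext a b
  by_contra hne
  rw [Matrix.zero_apply] at hne
  obtain ⟨c, hc⟩ := exists_valuation_mul_mul_le v hv (spectralProj A R l) (spectralProj A R i) a b
  have hx : v ((spectralProj A R l * T * spectralProj A R i) a b) ≠ 0 := v.ne_zero_iff.2 hne
  set x := v ((spectralProj A R l * T * spectralProj A R i) a b) with hxdef
  have hle : ∀ j : ℕ, x ≤ v l ^ j * c := fun j => by
    obtain ⟨k, B, hB⟩ := hT j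
    -- Sandwiching `T A ^ k = A ^ j B` between projectors turns powers of `A` into powers of `i` and
    -- `l`. As `v i = 1`, the unknown `k` disappears, while `v l ^ j` becomes arbitrarily small.
    have h1 : i ^ k • (spectralProj A R l * T * spectralProj A R i) =
        l ^ j • (spectralProj A R l * B.map Int.cast * spectralProj A R i) := by
      rw [← mul_smul_comm, ← pow_mul_spectralProj hA hi, ← mul_assoc, mul_assoc _ T, hB,
        ← mul_assoc, spectralProj_mul_pow hA hl, smul_mul_assoc, smul_mul_assoc]
    have h2 := congrArg (fun M => v (M a b)) h1
    simp only [Matrix.smul_apply, smul_eq_mul, map_mul, map_pow, hvi, one_pow, one_mul] at h2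
    rw [hxdef, h2]
    gcongr
    exact hc B
  have hc0 : c ≠ 0 := fun h => hx (le_zero_iff.1 (by simpa [h] using hle 0))
  obtain ⟨j, hj⟩ := exists_pow_lt₀ hvl (Units.mk0 (x * c⁻¹) (mul_ne_zero hx (inv_ne_zero hc0)))
  refine absurd (hle j) (not_le.2 ?_)
  rw [Units.val_mk0, ← div_eq_mul_inv, lt_div_iff₀ (zero_lt_iff.2 hc0)] at hj
  exact hj

end SpectralProjector

/-- The number of roots of a product of linear factors which lie in a prime `P` above `p` is the
multiplicity of zero as a root of the reduction modulo `p`. -/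
theorem card_filter_mem_eq_rootMultiplicity {O : Type*} [CommRing O] {ι : Type*} (R : Finset ι)
    (r : ι → O) (P : Ideal O) [P.IsPrime] [DecidablePred fun x => r x ∈ P] {p : ℕ} (hp : p.Prime)
    (hpP : (p : O) ∈ P) (h : ℤ[X]) (hh : h.map (Int.castRingHom O) = ∏ x ∈ R, (X - C (r x))) :
    (R.filter fun x => r x ∈ P).card =
      (h.map (Int.castRingHom (ZMod p))).rootMultiplicity 0 := by
  classical
  have := Fact.mk hp
  have hp0 : (p : O ⧸ P) = 0 := by
    rw [← map_natCast (Ideal.Quotient.mk P)]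
    exact Ideal.Quotient.eq_zero_iff_mem.2 hpP
  have : CharP (O ⧸ P) p := (CharP.charP_iff_prime_eq_zero hp).2 hp0
  -- Root multiplicities are unchanged under the field embedding `ZMod p → O ⧸ P`, where the
  -- polynomial splits.
  let f : ZMod p →+* O ⧸ P := ZMod.castHom dvd_rfl _
  rw [eq_rootMultiplicity_map (f := f) (RingHom.injective f) 0, Polynomial.map_map, map_zero]
  have : f.comp (Int.castRingHom (ZMod p)) =
      (Ideal.Quotient.mk P).comp (Int.castRingHom O) := RingHom.ext_int _ _
  rw [this, ← Polynomial.map_map, hh, Polynomial.map_prod, ← count_roots]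
  have h2 : ∏ x ∈ R, Polynomial.map (Ideal.Quotient.mk P) (X - C (r x)) =
      ((R.val.map fun x => Ideal.Quotient.mk P (r x)).map fun a => X - C a).prod := by
    simp only [Multiset.map_map, Polynomial.map_sub, map_X, map_C]
    rfl
  rw [h2, roots_multiset_prod_X_sub_C, Multiset.count_map, Finset.card, Finset.filter]
  congr 1
  refine Multiset.filter_congr fun x _ => ?_
  rw [eq_comm, Ideal.Quotient.eq_zero_iff_mem]

end ToroidalSolenoid

/-! ### Commutation with `A` by Galois conjugation -/

namespace ToroidalSolenoid
open Polynomial Matrix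
open scoped WithZero NumberField

/-- A rational matrix which is continuous for the topology with basis `A ^ j ℤⁿ` at zero commutes
with `A`; here `L` is a Galois number field containing the eigenvalues of `A`. -/
theorem commute_of_forall_exists_mul_pow_of_splits {n : ℕ} {A : Matrix (Fin n) (Fin n) ℤ}
    (L : Type*) [Field L] [NumberField L] [IsGalois ℚ L]
    (hirrQ : Irreducible (A.charpoly.map (Int.castRingHom ℚ)))
    (hsplit : (A.charpoly.map (Int.castRingHom L)).Splits)
    {p : ℕ} (hp : p.Prime) (hco : Nat.Coprime n (zeroMult A p))
    {T : Matrix (Fin n) (Fin n) ℚ}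
    (hT : ∀ j : ℕ, ∃ (k : ℕ) (B : Matrix (Fin n) (Fin n) ℤ),
      T * A.map Int.cast ^ k = A.map Int.cast ^ j * B.map Int.cast) :
    Commute (A.map Int.cast) T := by
  classical
  let h : ℚ[X] := A.charpoly.map (Int.castRingHom ℚ)
  have hmonic : h.Monic := A.charpoly_monic.map _
  set hL : L[X] := A.charpoly.map (Int.castRingHom L) with hLdef
  have hLh : hL = h.map (algebraMap ℚ L) := by
    rw [hLdef, Polynomial.map_map]
    congr 1
    exact RingHom.ext_int _ _
  have hLmonic : hL.Monic := A.charpoly_monic.map _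
  have hnodup : hL.roots.Nodup := by
    rw [hLh]
    exact nodup_roots (Separable.map hirrQ.separable)
  let R : Finset L := hL.roots.toFinset
  have hRmem : ∀ x, x ∈ R ↔ aeval x h = 0 := fun x => by
    rw [Multiset.mem_toFinset, mem_roots hLmonic.ne_zero, IsRoot, hLh, eval_map_algebraMap]
  have hprod : hL = ∏ x ∈ R, (X - C x) := by
    conv_lhs => rw [hsplit.eq_prod_roots_of_monic hLmonic]
    rw [Finset.prod_multiset_map_count]
    refine Finset.prod_congr rfl fun x hx => ?_
    rw [Multiset.count_eq_one_of_mem hnodup (Multiset.mem_toFinset.1 hx), pow_one]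
  have hdeg : hL.natDegree = n := by
    rw [hLdef, A.charpoly_monic.natDegree_map, A.charpoly_natDegree_eq_dim,
      Fintype.card_fin]
  have hRcard : R.card = n := by
    rw [Multiset.toFinset_card_of_nodup hnodup, ← hsplit.natDegree_eq_card_roots, hdeg]
  have hn : n ≠ 0 := fun h0 => by
    have := hirrQ.natDegree_pos
    rw [← natDegree_map (algebraMap ℚ L), ← hLh] at this
    omega
  have hRne : R.Nonempty := Finset.card_ne_zero.1 (hRcard ▸ hn)
  let AL : Matrix (Fin n) (Fin n) L := A.map Int.cast
  have hAL : AL.charpoly = ∏ x ∈ R, (X - C x) := by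
    rw [← hprod]
    change (A.map (Int.castRingHom L)).charpoly = _
    rw [Matrix.charpoly_map]
  let TL : Matrix (Fin n) (Fin n) L := T.map (algebraMap ℚ L)
  have hcast : ∀ B : Matrix (Fin n) (Fin n) ℤ,
      (B.map (Int.cast : ℤ → ℚ)).map (algebraMap ℚ L) = B.map Int.cast := fun B => by
    ext a b
    simp
  have hTL : ∀ j : ℕ, ∃ (k : ℕ) (B : Matrix (Fin n) (Fin n) ℤ),
      TL * AL ^ k = AL ^ j * B.map Int.cast := fun j => by
    obtain ⟨k, B, hB⟩ := hT j
    refine ⟨k, B, ?_⟩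
    have := congrArg (algebraMap ℚ L).mapMatrix hB
    simp only [map_mul, map_pow, RingHom.mapMatrix_apply, hcast] at this
    exact this
  obtain ⟨P, hPp, hPover⟩ : ∃ P : Ideal (𝓞 L), P.IsPrime ∧ (p : 𝓞 L) ∈ P := by
    have hpI : Prime (p : ℤ) := Nat.prime_iff_prime_int.1 hp
    have : (Ideal.span {(p : ℤ)}).IsPrime := (Ideal.span_singleton_prime hpI.ne_zero).2 hpI
    obtain ⟨P, hP1, hP2⟩ := Ideal.exists_ideal_over_prime_of_isIntegral_of_isDomain
      (S := 𝓞 L) (Ideal.span {(p : ℤ)}) (by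
        rw [(RingHom.injective_iff_ker_eq_bot _).1 (FaithfulSMul.algebraMap_injective ℤ (𝓞 L))]
        exact bot_le)
    refine ⟨P, hP1, ?_⟩
    have : (p : ℤ) ∈ P.comap (algebraMap ℤ (𝓞 L)) := hP2 ▸ Ideal.mem_span_singleton_self _
    simpa using this
  have hPbot : P ≠ ⊥ := fun hb => by
    rw [hb, Ideal.mem_bot, Nat.cast_eq_zero] at hPover
    exact hp.ne_zero hPover
  let w : IsDedekindDomain.HeightOneSpectrum (𝓞 L) := ⟨P, hPp, hPbot⟩
  let v : Valuation L ℤᵐ⁰ := w.valuation L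
  have hvint : ∀ m : ℤ, v m ≤ 1 := fun m => by
    simpa using w.valuation_le_one (K := L) (m : 𝓞 L)
  have hint : ∀ x ∈ R, IsIntegral ℤ x := fun x hx => by
    refine ⟨A.charpoly, A.charpoly_monic, ?_⟩
    rw [← (hRmem x).1 hx, aeval_def, eval₂_map]
    congr 1
    exact RingHom.ext_int _ _
  -- Stated for all `x` so that `r` is a total function; its values off `R` play no role.
  have hlift : ∀ x, ∃ y : 𝓞 L, x ∈ R → algebraMap (𝓞 L) L y = x := fun x => by
    by_cases hx : x ∈ R
    · exact ⟨⟨x, hint x hx⟩, fun _ => rfl⟩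
    · exact ⟨0, fun h => absurd h hx⟩
  choose r hr using hlift
  have hvR : ∀ x ∈ R, v x < 1 ↔ r x ∈ P := fun x hx => by
    conv_lhs => rw [← hr x hx]
    exact w.valuation_lt_one_iff_mem _
  have hvle : ∀ x ∈ R, v x ≤ 1 := fun x hx => by
    rw [← hr x hx]
    exact w.valuation_le_one _
  have hprodO : A.charpoly.map (Int.castRingHom (𝓞 L)) = ∏ x ∈ R, (X - C (r x)) := by
    refine Polynomial.map_injective (algebraMap (𝓞 L) L) NumberField.RingOfIntegers.coe_injective ?_
    rw [Polynomial.map_map, Polynomial.map_prod]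
    trans hL
    · rw [hLdef]
      congr 1
    · rw [hprod]
      refine Finset.prod_congr rfl fun x hx => ?_
      simp [hr x hx]
  let S := R.filter fun x => r x ∈ P
  have hScard : S.card = zeroMult A p :=
    card_filter_mem_eq_rootMultiplicity R r P hp hPover _ hprodO
  have hRσ : ∀ (σ : L ≃ₐ[ℚ] L), ∀ x ∈ R, σ • x ∈ R := fun σ x hx => by
    rw [hRmem] at hx ⊢
    rw [AlgEquiv.smul_def, ← AlgEquiv.coe_toAlgHom, aeval_algHom_apply, hx, map_zero]
  have hRtrans : ∀ x ∈ R, ∀ y ∈ R, ∃ σ : L ≃ₐ[ℚ] L, σ • x = y := fun x hx y hy => by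
    have hm : minpoly ℚ y = h :=
      (minpoly.eq_of_irreducible_of_monic hirrQ ((hRmem y).1 hy) hmonic).symm
    exact minpoly.exists_algEquiv_of_root (Algebra.IsAlgebraic.isAlgebraic y)
      (hm ▸ (hRmem x).1 hx)
  have hcomm : Commute AL TL := by
    refine commute_of_spectralProj_mul_mul hAL hRne fun l hl i hi hne => ?_
    refine eq_of_forall_smul_mem (G := L ≃ₐ[ℚ] L) (S := S) hRσ hRtrans (Finset.filter_subset _ _)
      (by rwa [hRcard, hScard]) hl hi fun σ hσ => ?_
    refine Finset.mem_filter.2 ⟨hRσ σ i hi, ?_⟩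
    rw [← hvR _ (hRσ σ i hi)]
    -- If `σ i` were a unit at `P`, the block at `(σ l, σ i)` would vanish; it is the `σ`-conjugate
    -- of the block at `(l, i)`.
    by_contra hlt
    have hi1 : v (σ i) = 1 := le_antisymm (hvle _ (hRσ σ i hi)) (not_lt.1 hlt)
    have h0 := spectralProj_mul_mul_eq_zero v hvint hAL hTL (hRσ σ l hl) (hRσ σ i hi)
      ((hvR _ (hRσ σ l hl)).2 (Finset.mem_filter.1 hσ).2) hi1
    have hmap := fun x => map_spectralProj (A := AL) (R := R) (σ : L →+* L) (by ext a b; simp [AL])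
      (Finset.eq_of_subset_of_card_le (Finset.image_subset_iff.2 (hRσ σ))
        (Finset.card_image_of_injective _ σ.injective).ge) x
    have hTmap : TL.map σ = TL := by
      ext a b
      simp [TL]
    refine hne (Matrix.map_injective σ.injective ?_)
    dsimp only
    rw [Matrix.map_zero _ (map_zero σ), ← h0]
    change (σ : L →+* L).mapMatrix _ = _
    rw [map_mul, map_mul]
    exact congrArg₂ (· * ·) (congrArg₂ (· * ·) (hmap l) hTmap) (hmap i)
  refine Matrix.map_injective (algebraMap ℚ L).injective ?_
  have := hcomm.eq
  simp only [AL, TL, ← hcast] at this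
  simpa only [Matrix.map_mul] using this

/-- A rational matrix which is continuous for the topology with basis
`A ^ j ℤⁿ` at zero commutes with `A`. -/
theorem commute_of_forall_exists_mul_pow {n : ℕ} {A : Matrix (Fin n) (Fin n) ℤ}
    (hirr : Irreducible A.charpoly) {p : ℕ} (hp : p.Prime) (hco : Nat.Coprime n (zeroMult A p))
    {T : Matrix (Fin n) (Fin n) ℚ}
    (hT : ∀ j : ℕ, ∃ (k : ℕ) (B : Matrix (Fin n) (Fin n) ℤ),
      T * A.map Int.cast ^ k = A.map Int.cast ^ j * B.map Int.cast) :
    Commute (A.map Int.cast) T := by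
  have hirrQ : Irreducible (A.charpoly.map (Int.castRingHom ℚ)) :=
    (A.charpoly_monic.irreducible_iff_irreducible_map_fraction_map (K := ℚ)).1 hirr
  have : IsSplittingField ℚ (A.charpoly.map (Int.castRingHom ℚ)).SplittingField
      (A.charpoly.map (Int.castRingHom ℚ)) := by
    convert IsSplittingField.splittingField (A.charpoly.map (Int.castRingHom ℚ))
    exact Subsingleton.elim _ _
  have := IsGalois.of_separable_splitting_field (F := ℚ)
    (E := (A.charpoly.map (Int.castRingHom ℚ)).SplittingField) hirrQ.separable
  have : NumberField (A.charpoly.map (Int.castRingHom ℚ)).SplittingField := ⟨⟩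
  refine commute_of_forall_exists_mul_pow_of_splits
    (A.charpoly.map (Int.castRingHom ℚ)).SplittingField hirrQ ?_ hp hco hT
  have := SplittingField.splits (A.charpoly.map (Int.castRingHom ℚ))
  rw [Polynomial.map_map] at this
  convert this using 2
  exact RingHom.ext_int _ _

end ToroidalSolenoid

/-! ### Characters and small subgroups of the circle -/

namespace ToroidalSolenoid
open Matrix Topology

/-- A continuous additive character of a real topological vector space lifts to a linear form. -/
theorem exists_lift_addCircle {E : Type*} [AddCommGroup E] [Module ℝ E] [TopologicalSpace E]
    [IsTopologicalAddGroup E] [ContinuousSMul ℝ E] [LocallyPathConnectedSpace E]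
    (φ : E →+ UnitAddCircle) (hφ : Continuous φ) :
    ∃ w : E →L[ℝ] ℝ, ∀ x, φ x = ((w x : ℝ) : UnitAddCircle) := by
  have : ContractibleSpace E := RealTopologicalVectorSpace.contractibleSpace
  obtain ⟨F, ⟨hF0, hF⟩, -⟩ := (AddCircle.isCoveringMap_coe (1 : ℝ)).existsUnique_continuousMap_lifts
    ⟨φ, hφ⟩ (0 : E) (0 : ℝ) (by simp)
  have hF : ∀ x, ((F x : ℝ) : UnitAddCircle) = φ x := fun x => congrFun hF x
  have hadd : ∀ x y, F (x + y) = F x + F y := fun x y => by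
    -- The additivity defect of the lift is continuous and integer-valued on a connected space, and
    -- vanishes at the origin.
    have hc : Continuous fun z : E × E => F (z.1 + z.2) - F z.1 - F z.2 := by fun_prop
    have hmem : ∀ z : E × E, F (z.1 + z.2) - F z.1 - F z.2 ∈ Set.range (Int.cast : ℤ → ℝ) :=
      fun z => by
      have : ((F (z.1 + z.2) - F z.1 - F z.2 : ℝ) : UnitAddCircle) = 0 := by
        rw [AddCircle.coe_sub, AddCircle.coe_sub, hF, hF, hF, map_add]
        abel
      obtain ⟨m, hm⟩ := (AddCircle.coe_eq_zero_iff (1 : ℝ)).1 this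
      exact ⟨m, by simpa using hm⟩
    have hdisc : IsTotallyDisconnected (Set.range (Int.cast : ℤ → ℝ)) :=
      (Set.countable_range _).isTotallyDisconnected
    have hsub := hdisc _ (Set.range_subset_iff.2 hmem) (isPreconnected_range hc)
    have := hsub ⟨(x, y), rfl⟩ ⟨(0, 0), rfl⟩
    simp only [add_zero, hF0, sub_zero] at this
    linarith
  let G : E →+ ℝ := AddMonoidHom.mk' F hadd
  exact ⟨G.toRealLinearMap F.continuous, fun x => (hF x).symm⟩

/-- The circle has no small subgroups. -/
theorem eq_zero_of_forall_norm_nsmul_lt {a : UnitAddCircle} (h : ∀ m : ℕ, ‖m • a‖ < 1 / 4) :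
    a = 0 := by
  have hdouble : ∀ b : UnitAddCircle, ‖b‖ < 1 / 4 → ‖2 • b‖ = 2 * ‖b‖ := fun b hb => by
    induction b using QuotientAddGroup.induction_on with | _ x =>
    have h1 : ‖(x : UnitAddCircle)‖ = |x - round x| := UnitAddCircle.norm_eq
    change ‖(x : UnitAddCircle)‖ < 1 / 4 at hb
    change ‖2 • (x : UnitAddCircle)‖ = 2 * ‖(x : UnitAddCircle)‖
    -- Below `1 / 4`, doubling the representative nearest zero stays within `1 / 2`, so the norm
    -- doubles exactly.
    have h2 : 2 • (x : UnitAddCircle) = ((2 * (x - round x) : ℝ) : UnitAddCircle) := by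
      have : ((round x : ℝ) : UnitAddCircle) = 0 :=
        (AddCircle.coe_eq_zero_iff (1 : ℝ)).2 ⟨round x, by simp⟩
      rw [mul_sub, AddCircle.coe_sub, two_mul (round x : ℝ), AddCircle.coe_add, this, two_nsmul,
        two_mul, AddCircle.coe_add]
      simp
    rw [h1] at hb ⊢
    rw [h2, (AddCircle.norm_coe_eq_abs_iff (1 : ℝ) one_ne_zero).2, abs_mul, abs_two]
    rw [abs_mul, abs_two, abs_one]
    linarith
  have hpow : ∀ m : ℕ, ‖2 ^ m • a‖ = 2 ^ m * ‖a‖ := fun m => by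
    induction m with
    | zero => simp
    | succ m ih => rw [pow_succ', mul_nsmul', hdouble _ (h _), ih, pow_succ', mul_assoc]
  by_contra hne
  have hpos : 0 < ‖a‖ := norm_pos_iff.2 hne
  obtain ⟨m, hm⟩ := pow_unbounded_of_one_lt (1 / ‖a‖) (one_lt_two (α := ℝ))
  have h1 := h (2 ^ m)
  rw [hpow m] at h1
  rw [div_lt_iff₀ hpos] at hm
  linarith

/-! ### One-parameter subgroups and matrices of endomorphisms -/

section Flow

variable {n : ℕ} {A : Matrix (Fin n) (Fin n) ℤ}

theorem isUnit_det_map_intCast {K : Type*} [Field K] [CharZero K] (hdet : A.det ≠ 0) :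
    IsUnit (A.map (Int.cast : ℤ → K)).det := by
  have : (A.map (Int.cast : ℤ → K)).det = (A.det : K) := ((Int.castRingHom K).map_det A).symm
  rw [this]
  exact (Int.cast_ne_zero.2 hdet).isUnit

/-- The one-parameter subgroups of the solenoid: `x ↦ ([A⁻ʲ x])_j`. -/
noncomputable def flow (hdet : A.det ≠ 0) : (Fin n → ℝ) →+ solenoid A where
  toFun x := ⟨fun j i => ((((A.map (Int.cast : ℤ → ℝ))⁻¹ ^ j *ᵥ x) i : ℝ) : UnitAddCircle),
    fun j => by
      rw [torusMap_coe, mulVec_mulVec, pow_succ', mul_nonsing_inv_cancel_left _ _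
        (isUnit_det_map_intCast hdet)]⟩
  map_zero' := by
    ext j i
    simp
  map_add' x y := by
    ext j i
    simp [mulVec_add]

theorem flow_apply (hdet : A.det ≠ 0) (x : Fin n → ℝ) (j : ℕ) (i : Fin n) :
    (flow hdet x).1 j i =
      ((((A.map (Int.cast : ℤ → ℝ))⁻¹ ^ j *ᵥ x) i : ℝ) : UnitAddCircle) := rfl

theorem continuous_flow (hdet : A.det ≠ 0) : Continuous (flow hdet) := by
  refine Continuous.subtype_mk (continuous_pi fun j => continuous_pi fun i => ?_) _
  refine (AddCircle.continuous_mk' 1).comp ?_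
  exact (continuous_apply i).comp (Continuous.matrix_mulVec continuous_const continuous_id)

theorem apply_eq_of_apply_eq {z w : solenoid A} {k : ℕ} (h : z.1 k = w.1 k) {j : ℕ} (hj : j ≤ k) :
    z.1 j = w.1 j := by
  induction k, hj using Nat.le_induction with
  | base => exact h
  | succ k _ ih => exact ih (by rw [← z.2 k, ← w.2 k, h])

/-- A basic neighbourhood restricts finitely many coordinates, all determined by the one of largest
index. -/
theorem exists_forall_apply_eq_mem {U : Set (solenoid A)} {w : solenoid A} (hU : U ∈ 𝓝 w) :
    ∃ k, ∀ z : solenoid A, z.1 k = w.1 k → z ∈ U := by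
  obtain ⟨V, hV, hVU⟩ := mem_nhds_subtype _ _ _ |>.1 hU
  obtain ⟨I, u, hu, huV⟩ := Filter.mem_pi'.1 (nhds_pi (a := w.1) ▸ hV)
  refine ⟨I.sup id, fun z hz => hVU (huV fun j hj => ?_)⟩
  have hjk : j ≤ I.sup id := Finset.le_sup (f := id) hj
  rw [apply_eq_of_apply_eq hz hjk]
  exact mem_of_mem_nhds (hu j)

theorem denseRange_flow (hdet : A.det ≠ 0) : DenseRange (flow hdet) := by
  intro w
  rw [mem_closure_iff_nhds]
  intro U hU
  obtain ⟨k, hk⟩ := exists_forall_apply_eq_mem hU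
  choose y hy using fun i => QuotientAddGroup.mk_surjective (w.1 k i)
  -- The `k`-th coordinate of the flow at `A ^ k y` is `[y]`, so any value is attained.
  refine ⟨_, hk (flow hdet ((A.map Int.cast) ^ k *ᵥ y)) ?_, ⟨_, rfl⟩⟩
  ext i
  rw [flow_apply, mulVec_mulVec, inv_pow', nonsing_inv_mul _ (by
    rw [det_pow]
    exact (isUnit_det_map_intCast hdet).pow k), one_mulVec]
  exact hy i

/-- A continuous homomorphism from the solenoid to a torus acts on the one-parameter subgroups by a
real matrix, which is integral up to a power of `A`. -/
theorem exists_matrix_of_continuous (hdet : A.det ≠ 0) (φ : solenoid A →+ UnitAddTorus (Fin n))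
    (hφ : Continuous φ) :
    ∃ T : Matrix (Fin n) (Fin n) ℝ,
      (∀ x, φ (flow hdet x) = fun i => (((T *ᵥ x) i : ℝ) : UnitAddCircle)) ∧
      ∃ (k : ℕ) (B : Matrix (Fin n) (Fin n) ℤ), T * A.map Int.cast ^ k = B.map Int.cast := by
  have hlift : ∀ i, ∃ w : (Fin n → ℝ) →L[ℝ] ℝ, ∀ x, φ (flow hdet x) i = ((w x : ℝ) : UnitAddCircle) :=
    fun i => exists_lift_addCircle ((Pi.evalAddMonoidHom _ i).comp (φ.comp (flow hdet)))
      ((continuous_apply i).comp (hφ.comp (continuous_flow hdet)))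
  choose w hw using hlift
  let T : Matrix (Fin n) (Fin n) ℝ := LinearMap.toMatrix' (LinearMap.pi fun i => (w i).toLinearMap)
  have hT : ∀ x i, (T *ᵥ x) i = w i x := fun x i => by
    rw [← Matrix.toLin'_apply, Matrix.toLin'_toMatrix']
    rfl
  refine ⟨T, fun x => funext fun i => by rw [hT, hw], ?_⟩
  have hU : {z : solenoid A | ∀ i, ‖φ z i‖ < 1 / 4} ∈ 𝓝 0 := by
    have hopen : IsOpen {z : solenoid A | ∀ i, ‖φ z i‖ < 1 / 4} := by
      simp only [Set.ofPred_forall]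
      refine isOpen_iInter_of_finite fun i => isOpen_lt ?_ continuous_const
      exact ((continuous_apply i).comp hφ).norm
    exact hopen.mem_nhds (by simp)
  obtain ⟨k, hk⟩ := exists_forall_apply_eq_mem hU
  -- The points with `z_k = 0` form a subgroup inside the neighbourhood, so `φ` kills it. It
  -- contains the flow at `A ^ k e_c`, which makes column `c` of `T A ^ k` integral.
  have hker : ∀ z : solenoid A, z.1 k = 0 → ∀ i, φ z i = 0 := fun z hz i =>
    eq_zero_of_forall_norm_nsmul_lt fun m => by
      have := hk (m • z) (by
        change m • z.1 k = 0
        rw [hz, smul_zero]) i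
      rwa [map_nsmul] at this
  have hcol : ∀ i c, ∃ b : ℤ,
      (b : ℝ) = (T * A.map (Int.cast : ℤ → ℝ) ^ k : Matrix (Fin n) (Fin n) ℝ) i c := fun i c => by
    have h0 := hker (flow hdet (A.map Int.cast ^ k *ᵥ Pi.single c 1)) (by
      ext i
      rw [flow_apply, mulVec_mulVec, inv_pow', nonsing_inv_mul _ (by
        rw [det_pow]
        exact (isUnit_det_map_intCast hdet).pow k), one_mulVec]
      refine (AddCircle.coe_eq_zero_iff (1 : ℝ)).2 ⟨(Pi.single c 1 : Fin n → ℤ) i, ?_⟩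
      by_cases hic : i = c
      · subst hic
        simp
      · simp [hic]) i
    rw [hw, ← hT, mulVec_mulVec] at h0
    obtain ⟨b, hb⟩ := (AddCircle.coe_eq_zero_iff (1 : ℝ)).1 h0
    exact ⟨b, by simpa using hb⟩
  choose B hB using hcol
  exact ⟨k, Matrix.of B, by
    ext i c
    simp [hB]⟩

theorem eq_of_forall_coe_mulVec_eq {S T : Matrix (Fin n) (Fin n) ℝ}
    (h : ∀ x i, (((S *ᵥ x) i : ℝ) : UnitAddCircle) = (((T *ᵥ x) i : ℝ) : UnitAddCircle)) :
    S = T := by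
  ext i c
  have hint : ∀ t : ℝ, ∃ m : ℤ, (m : ℝ) = t * (S i c - T i c) := fun t => by
    have h1 : (((S *ᵥ Pi.single c t) i - (T *ᵥ Pi.single c t) i : ℝ) : UnitAddCircle) = 0 := by
      rw [AddCircle.coe_sub, h, sub_self]
    obtain ⟨m, hm⟩ := (AddCircle.coe_eq_zero_iff (1 : ℝ)).1 h1
    refine ⟨m, ?_⟩
    simp at hm
    rw [hm]
    ring
  by_contra hne
  -- This scaling would make `1 / 2` an integer.
  obtain ⟨m, hm⟩ := hint (1 / (2 * (S i c - T i c)))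
  have hne' : S i c - T i c ≠ 0 := sub_ne_zero.2 hne
  have h2 : (2 : ℝ) * m = 1 := by
    rw [hm]
    field_simp
  have h3 : 2 * m = 1 := by exact_mod_cast h2
  omega

/-- A continuous endomorphism of the solenoid acts on the one-parameter subgroups by a rational
matrix which is continuous for the topology with basis `A ^ j ℤⁿ` at zero. -/
theorem exists_ratMatrix_of_continuous (hdet : A.det ≠ 0) (f : solenoid A →+ solenoid A)
    (hf : Continuous f) :
    ∃ T : Matrix (Fin n) (Fin n) ℚ,
      (∀ x, f (flow hdet x) = flow hdet (T.map (algebraMap ℚ ℝ) *ᵥ x)) ∧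
      ∀ j : ℕ, ∃ (k : ℕ) (B : Matrix (Fin n) (Fin n) ℤ),
        T * A.map Int.cast ^ k = A.map Int.cast ^ j * B.map Int.cast := by
  have hcomp : ∀ j, Continuous fun z => (f z).1 j := fun j =>
    (continuous_apply j).comp (continuous_subtype_val.comp hf)
  choose T hT hB using fun j => exists_matrix_of_continuous hdet
    ((Pi.evalAddMonoidHom _ j).comp ((solenoid A).subtype.comp f)) (hcomp j)
  have hT : ∀ j x, (f (flow hdet x)).1 j = fun i => (((T j *ᵥ x) i : ℝ) : UnitAddCircle) := hT
  have hstep : ∀ j, A.map Int.cast * T (j + 1) = T j := fun j =>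
    eq_of_forall_coe_mulVec_eq fun x i => by
      have := (f (flow hdet x)).2 j
      rw [hT, hT, torusMap_coe, mulVec_mulVec] at this
      exact congrFun this i
  -- The sought matrix is `T 0`: integrality of `T j * A ^ k` for each `j` becomes divisibility of
  -- `T 0 * A ^ k` by `A ^ j`.
  have hT0 : ∀ j, T 0 = A.map Int.cast ^ j * T j := fun j => by
    induction j with
    | zero => simp
    | succ j ih => rw [ih, ← hstep j, pow_succ, mul_assoc]
  have hcast : ∀ B : Matrix (Fin n) (Fin n) ℤ,
      (B.map (Int.cast : ℤ → ℚ)).map (algebraMap ℚ ℝ) = B.map Int.cast := fun B => by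
    ext a b
    simp
  have hpow : ∀ k : ℕ, (A.map (Int.cast : ℤ → ℚ) ^ k).map (algebraMap ℚ ℝ) = A.map Int.cast ^ k :=
    fun k => by
      rw [← hcast A]
      exact map_pow (algebraMap ℚ ℝ).mapMatrix _ k
  have hunit : ∀ (K : Type) [Field K] [CharZero K] (k : ℕ),
      IsUnit (A.map (Int.cast : ℤ → K) ^ k).det := fun K _ _ k => by
    rw [det_pow]
    exact (isUnit_det_map_intCast hdet).pow k
  obtain ⟨k₀, B₀, hB₀⟩ := hB 0
  -- Rationality: `T 0 = B₀ A ^ (-k₀)` with `B₀` and `A` integral.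
  obtain ⟨Q, h1⟩ : ∃ Q : Matrix (Fin n) (Fin n) ℚ, Q * A.map Int.cast ^ k₀ = B₀.map Int.cast :=
    ⟨B₀.map Int.cast * (A.map Int.cast ^ k₀)⁻¹, nonsing_inv_mul_cancel_right _ _ (hunit ℚ k₀)⟩
  have hQ : Q.map (algebraMap ℚ ℝ) = T 0 := by
    have h2 : Q.map (algebraMap ℚ ℝ) * A.map Int.cast ^ k₀ = T 0 * A.map Int.cast ^ k₀ := by
      rw [hB₀, ← hcast B₀, ← h1, Matrix.map_mul, hpow]
    rw [← mul_nonsing_inv_cancel_right _ (Q.map (algebraMap ℚ ℝ)) (hunit ℝ k₀), h2,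
      mul_nonsing_inv_cancel_right _ _ (hunit ℝ k₀)]
  refine ⟨Q, fun x => ?_, fun j => ?_⟩
  · ext j i
    rw [hT, flow_apply, hQ, hT0 j, mulVec_mulVec, inv_pow',
      nonsing_inv_mul_cancel_left _ _ (hunit ℝ j)]
  · obtain ⟨k, B, hkB⟩ := hB j
    refine ⟨k, B, Matrix.map_injective (algebraMap ℚ ℝ).injective ?_⟩
    dsimp only
    rw [Matrix.map_mul, Matrix.map_mul, hQ, hpow, hpow, hcast, ← hkB, ← mul_assoc, ← hT0]

end Flow

end ToroidalSolenoid

/-! ### The main theorem -/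

open ToroidalSolenoid Matrix in
theorem mainTheorem6 (n : ℕ) (A : Matrix (Fin n) (Fin n) ℤ)
    (hdet : A.det ≠ 0)
    (hirr : Irreducible A.charpoly)
    (hP : (ToroidalSolenoid.primesPrime A).Nonempty)
    (hp : ∃ p : ℕ, p.Prime ∧ Nat.Coprime n (ToroidalSolenoid.zeroMult A p)) :
    (∀ f g : ToroidalSolenoid.contEnd (ToroidalSolenoid.solenoid A), f * g = g * f) ∧
    ToroidalSolenoid.dynEnd (ToroidalSolenoid.solenoid A) (ToroidalSolenoid.shift A) =
      ToroidalSolenoid.contEnd (ToroidalSolenoid.solenoid A) := by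
  obtain ⟨p, hp, hco⟩ := hp
  have hirrQ : Irreducible (A.map (Int.cast : ℤ → ℚ)).charpoly := by
    change Irreducible (A.map (Int.castRingHom ℚ)).charpoly
    rw [Matrix.charpoly_map]
    exact (A.charpoly_monic.irreducible_iff_irreducible_map_fraction_map (K := ℚ)).1 hirr
  have hcomm : ∀ f g : contEnd (solenoid A), f * g = g * f := fun f g => by
    obtain ⟨S, hS, hSA⟩ := exists_ratMatrix_of_continuous hdet f.1 f.2
    obtain ⟨T, hT, hTA⟩ := exists_ratMatrix_of_continuous hdet g.1 g.2
    have hST : Commute S T := commute_of_commute_of_irreducible_charpoly hirrQ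
      (commute_of_forall_exists_mul_pow hirr hp hco hSA).symm
      (commute_of_forall_exists_mul_pow hirr hp hco hTA).symm
    have hS : ∀ x, f.1 (flow hdet x) = flow hdet (S.map (algebraMap ℚ ℝ) *ᵥ x) := hS
    have hT : ∀ x, g.1 (flow hdet x) = flow hdet (T.map (algebraMap ℚ ℝ) *ᵥ x) := hT
    refine Subtype.ext (DFunLike.coe_injective ?_)
    -- Two continuous maps into a Hausdorff space that agree on the dense flow are equal.
    refine (denseRange_flow hdet).equalizer (f * g).2 (g * f).2 (funext fun x => ?_)
    change f.1 (g.1 (flow hdet x)) = g.1 (f.1 (flow hdet x))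
    rw [hT, hS, hS, hT, Matrix.mulVec_mulVec, Matrix.mulVec_mulVec, ← Matrix.map_mul,
      ← Matrix.map_mul, hST.eq]
  refine ⟨hcomm, le_antisymm (fun f hf => hf.1) fun f hf => ⟨hf, fun z => ?_⟩⟩
  let s : contEnd (solenoid A) := ⟨(shift A : solenoid A →+ solenoid A), (shift A).continuous⟩
  exact DFunLike.congr_fun (congrArg Subtype.val (hcomm ⟨f, hf⟩ s)) z
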